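/- Let $k$ be a field of arbitrary characteristic. For integers $d,\delta,\mu_1,\dots,\mu_r\ge 0$ let $l(d,\delta,\mu_1,\dots,\mu_r)$ denote the dimension of the space of homogeneous polynomials of degree $\delta$ in $d+1$ variables that vanish to order at least $\mu_i$ at $p_i$ for $i=1,\dots,r$, where $p_1,\dots,p_r$ are generic points of $\mathbb P^d$ over $k$: their homogeneous coordinates are independent indeterminates over $k$, and the polynomials have coefficients in the field generated over $k$ by these coordinates. Write $l(d,\delta,\mu^r)$ when $\mu_1=\dots=\mu_r=\mu$. **Theorem.** Let $d\ge 2$, let $r=s^d$ for some integer $s\ge 0$, and let $\delta,\mu\ge 0$ be integers. If $\delta<\sqrt[d]{r}\,\mu$, then $$l(d,\delta,\mu^r)=0 .$$ The same holds for general points: there is a nonzero polynomial $F$ over $k$ in $r(d+1)$ variables such that for every extension field $L$ of $k$ and all points $p_1,\dots,p_r\in\mathbb P^d(L)$ having homogeneous coordinates at which $F$ does not vanish, the only homogeneous polynomial of degree $\delta$ over $L$ that vanishes to order at least $\mu$ at each $p_i$ is $0$. -/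

import Mathlib

universe u

open MvPolynomial

noncomputable section

namespace FatPoints

/-- The polynomials `P` that vanish to order at least `m` at the point `a`: the Taylor expansion
`P(a + X)` has no term of degree less than `m`. For a form `P` and `a ≠ 0` this says that `P`
vanishes to order at least `m` at the point `[a]` of projective space; it does not depend on the
representative `a`, see `mem_vanishing_smul_iff`. -/
def vanishing {K : Type*} [Field K] {σ : Type*} (a : σ → K) (m : ℕ) :
    Submodule K (MvPolynomial σ K) where
  carrier := {P | ∀ e : σ →₀ ℕ, e.degree < m → coeff e (aeval (fun j => C (a j) + X j) P) = 0}
  zero_mem' := by intro e _; simp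
  add_mem' := by
    intro P Q hP hQ e he
    rw [map_add, coeff_add, hP e he, hQ e he, add_zero]
  smul_mem' := by
    intro c P hP e he
    rw [map_smul, coeff_smul, hP e he, smul_zero]

/-- The space of forms of degree `δ` in `d + 1` variables over `K` that vanish to order at least
`μ i` at the point of `ℙ^d(K)` with homogeneous coordinates `p i`, for every `i`. -/
def forms {K : Type*} [Field K] (d δ : ℕ) {r : ℕ} (p : Fin r → Fin (d + 1) → K)
    (μ : Fin r → ℕ) : Submodule K (MvPolynomial (Fin (d + 1)) K) :=
  homogeneousSubmodule (Fin (d + 1)) K δ ⊓ ⨅ i, vanishing (p i) (μ i)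

/-- The field generated over `k` by the independent homogeneous coordinates of `r` points of
`ℙ^d`. -/
abbrev GenericField (k : Type*) [Field k] (d r : ℕ) : Type _ :=
  FractionRing (MvPolynomial (Fin r × Fin (d + 1)) k)

/-- The `r` generic points of `ℙ^d`: all their homogeneous coordinates are independent
indeterminates over `k`. -/
def genericPoints (k : Type*) [Field k] (d r : ℕ) : Fin r → Fin (d + 1) → GenericField k d r :=
  fun i j => algebraMap (MvPolynomial (Fin r × Fin (d + 1)) k) _ (X (i, j))

/-- `l(d, δ, μ₁, …, μ_r)` over the base field `k`: the dimension of the space of forms of degree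
`δ` in `d + 1` variables that vanish to orders `μ₁, …, μ_r` at `r` generic points of `ℙ^d`. -/
def l (k : Type*) [Field k] (d δ : ℕ) {r : ℕ} (μ : Fin r → ℕ) : ℕ :=
  Module.finrank (GenericField k d r) (forms d δ (genericPoints k d r) μ)

/-- The spaces of forms are finite dimensional, so that `Module.finrank` is their dimension. -/
instance forms_finite {K : Type*} [Field K] (d δ : ℕ) {r : ℕ} (p : Fin r → Fin (d + 1) → K)
    (μ : Fin r → ℕ) : Module.Finite K (forms d δ p μ) := by
  refine Submodule.finiteDimensional_of_le (S₂ := restrictTotalDegree (Fin (d + 1)) K δ) ?_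
  intro P hP
  rw [mem_restrictTotalDegree]
  exact ((mem_homogeneousSubmodule δ P).1 hP.1).totalDegree_le

/-- The order of vanishing of a form does not depend on the choice of homogeneous coordinates. -/
theorem mem_vanishing_smul_iff {K : Type*} [Field K] {σ : Type*} {δ : ℕ} {P : MvPolynomial σ K}
    (hP : P.IsHomogeneous δ) (a : σ → K) (m : ℕ) {c : K} (hc : c ≠ 0) :
    P ∈ vanishing (c • a) m ↔ P ∈ vanishing a m := by
  have key : ∀ e : σ →₀ ℕ,
      c ^ e.degree * coeff e (aeval (fun j => C ((c • a) j) + X j) P) =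
        c ^ δ * coeff e (aeval (fun j => C (a j) + X j) P) := by
    intro e
    have h1 : ∀ Q : MvPolynomial σ K,
        coeff e (aeval (fun j => C c * X j) Q : MvPolynomial σ K) = c ^ e.degree * coeff e Q := by
      classical
      intro Q
      induction Q using MvPolynomial.induction_on' with
      | monomial u b =>
        have : (aeval (fun j => C c * X j) (monomial u b) : MvPolynomial σ K) =
            monomial u (c ^ u.degree * b) := by
          rw [aeval_monomial, Finsupp.prod]
          simp only [mul_pow, Finset.prod_mul_distrib, Finset.prod_pow_eq_pow_sum]
          rw [monomial_eq, Finsupp.prod, algebraMap_eq, C_mul, C_pow, Finsupp.degree_apply]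
          ring
        rw [this, coeff_monomial, coeff_monomial]
        split_ifs with h
        · rw [h]
        · simp
      | add p q hp hq => rw [map_add, coeff_add, hp, hq, coeff_add, mul_add]
    have h2 : ∀ f : σ → MvPolynomial σ K,
        aeval (fun j => C c * f j) P = C (c ^ δ) * aeval f P := by
      intro f
      rw [aeval_def, aeval_def, eval₂_eq, eval₂_eq, Finset.mul_sum]
      refine Finset.sum_congr rfl fun u hu => ?_
      have hdeg : ∑ i ∈ u.support, u i = δ := by
        rw [← hP (mem_support_iff.1 hu), ← Finsupp.degree_apply, Finsupp.degree_eq_weight_one]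
        rfl
      simp only [mul_pow, Finset.prod_mul_distrib, Finset.prod_pow_eq_pow_sum, hdeg, C_pow]
      ring
    rw [← h1, ← coeff_C_mul, ← h2, ← AlgHom.comp_apply, comp_aeval]
    congr 3
    funext j
    simp [mul_add]
  constructor <;> intro h e he
  · have := key e
    rw [h e he, mul_zero] at this
    exact (mul_eq_zero.1 this.symm).resolve_left (pow_ne_zero _ hc)
  · have := key e
    rw [h e he, mul_zero] at this
    exact (mul_eq_zero.1 this).resolve_left (pow_ne_zero _ hc)

end FatPoints

end

noncomputable section

namespace FatPoints

/-! Vanishing to given orders at given points is a linear system in the coefficients of a form. It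
has only the zero solution exactly when some maximal minor is nonzero, and each minor is a
polynomial over `k` in the coordinates of the points. Hence one good configuration over one
extension of `k` settles both general and generic points (`exists_certificate_of_forms_eq_bot`).

A grid `A ^ d` with `#A = s` in an affine chart is such a configuration
(`eq_zero_of_vanishing_grid`), by induction on the number of variables. Let `t` be the degree of `P`
in the first variable. Fix a point of the smaller grid and a Taylor exponent `e` there. The
coefficients at `e` form a univariate polynomial of degree at most `t` that vanishes to order `m -
|e|` on `A`, so it is zero when `t < #A * (m - |e|)`. Thus the leading coefficient, of degree at
most `δ - t`, vanishes to order `m - ⌊t / #A⌋` on the smaller grid. The bound persists because `#A *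
⌊t / #A⌋ ≤ t`, so the leading coefficient is zero, a contradiction. -/

/-! ### Polynomials vanishing to high order on a grid -/

/-- The univariate polynomial formed by the coefficients of a fixed monomial `e` in the
coefficients of `Q`. -/
def coeffwise {K σ : Type*} [CommSemiring K] (e : σ →₀ ℕ) (Q : Polynomial (MvPolynomial σ K)) :
    Polynomial K :=
  ∑ i ∈ Q.support, Polynomial.monomial i (coeff e (Q.coeff i))

theorem coeff_coeffwise {K σ : Type*} [CommSemiring K] (e : σ →₀ ℕ)
    (Q : Polynomial (MvPolynomial σ K)) (i : ℕ) :
    (coeffwise e Q).coeff i = coeff e (Q.coeff i) := by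
  rw [coeffwise, Polynomial.finsetSum_coeff]
  simp only [Polynomial.coeff_monomial, Finset.sum_ite_eq']
  split_ifs with h
  · rfl
  · rw [Polynomial.notMem_support_iff.1 h, coeff_zero]

theorem coeffwise_add {K σ : Type*} [CommSemiring K] (e : σ →₀ ℕ)
    (Q R : Polynomial (MvPolynomial σ K)) :
    coeffwise e (Q + R) = coeffwise e Q + coeffwise e R := by
  ext i
  simp [coeff_coeffwise]

theorem coeffwise_C_mul_map {K σ : Type*} [CommSemiring K] (e : σ →₀ ℕ)
    (s : MvPolynomial σ K) (g : Polynomial K) :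
    coeffwise e (Polynomial.C s * g.map C) = Polynomial.C (coeff e s) * g := by
  ext i
  simp [coeff_coeffwise, mul_comm s, mul_comm (coeff e s)]

/-- The shift moves only the outer variable, and by a scalar of `K`, so it commutes with the
`K`-linear extraction of the coefficient at `e`. -/
theorem coeffwise_comp_X_add_C {K σ : Type*} [CommSemiring K] (e : σ →₀ ℕ) (a : K)
    (Q : Polynomial (MvPolynomial σ K)) :
    coeffwise e (Q.comp (Polynomial.X + Polynomial.C (C a))) =
      (coeffwise e Q).comp (Polynomial.X + Polynomial.C a) := by
  induction Q using Polynomial.induction_on' with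
  | add p q hp hq =>
    rw [Polynomial.add_comp, coeffwise_add, hp, hq, coeffwise_add, Polynomial.add_comp]
  | monomial n s =>
    have h1 := coeffwise_C_mul_map e s (Polynomial.X ^ n)
    have h2 := coeffwise_C_mul_map e s ((Polynomial.X + Polynomial.C a) ^ n)
    simp only [Polynomial.map_pow, Polynomial.map_X, Polynomial.map_add, Polynomial.map_C] at h1 h2
    rw [← Polynomial.C_mul_X_pow_eq_monomial, h1]
    simpa using h2

/-- A univariate polynomial that vanishes to order `m` on a finite set `A` is zero if its degree
is less than `#A * m`. -/
theorem eq_zero_of_forall_X_pow_dvd_comp {K : Type*} [Field K] (A : Finset K) (m : ℕ)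
    (q : Polynomial K) (hq : q.natDegree < A.card * m)
    (h : ∀ a ∈ A, Polynomial.X ^ m ∣ q.comp (Polynomial.X + Polynomial.C a)) : q = 0 := by
  by_contra hne
  have hdvd : ∏ a ∈ A, (Polynomial.X - Polynomial.C a) ^ m ∣ q := by
    refine Finset.prod_dvd_of_coprime (fun a _ b _ hab => ?_)
      fun a ha => Polynomial.X_sub_C_pow_dvd_iff.2 (h a ha)
    exact (Polynomial.pairwise_coprime_X_sub_C Function.injective_id hab).pow
  have hle := Polynomial.natDegree_le_of_dvd hdvd hne
  rw [Polynomial.natDegree_prod _ _ fun a _ => pow_ne_zero _ (Polynomial.X_sub_C_ne_zero a)] at hle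
  simp only [Polynomial.natDegree_pow, Polynomial.natDegree_X_sub_C, mul_one, Finset.sum_const,
    smul_eq_mul] at hle
  omega

/-- Translation of the variables, separated into the first variable and the others. -/
theorem finSuccEquiv_translate {K : Type*} [CommRing K] {n : ℕ} (a₀ : K) (a : Fin n → K)
    (P : MvPolynomial (Fin (n + 1)) K) :
    finSuccEquiv K n (aeval (fun j => C ((Fin.cons a₀ a : Fin (n + 1) → K) j) + X j) P) =
      ((finSuccEquiv K n P).map (aeval (fun j => C (a j) + X j) :
        MvPolynomial (Fin n) K →ₐ[K] MvPolynomial (Fin n) K).toRingHom).comp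
        (Polynomial.X + Polynomial.C (C a₀)) := by
  induction P using MvPolynomial.induction_on with
  | C c => simp [finSuccEquiv_apply]
  | add p q hp hq => simp only [map_add, hp, hq, Polynomial.map_add, Polynomial.add_comp]
  | mul_X p j hp =>
    have hX : finSuccEquiv K n
        (aeval (fun j => C ((Fin.cons a₀ a : Fin (n + 1) → K) j) + X j)
          (X j : MvPolynomial (Fin (n + 1)) K)) =
        ((finSuccEquiv K n (X j : MvPolynomial (Fin (n + 1)) K)).map (aeval (fun j => C (a j) + X j) :
          MvPolynomial (Fin n) K →ₐ[K] MvPolynomial (Fin n) K).toRingHom).comp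
          (Polynomial.X + Polynomial.C (C a₀)) := by
      induction j using Fin.cases with
      | zero =>
        rw [aeval_X, map_add, finSuccEquiv_X_zero, Fin.cons_zero, Polynomial.map_X,
          Polynomial.X_comp, add_comm]
        simp [finSuccEquiv_apply]
      | succ j =>
        rw [aeval_X, map_add, finSuccEquiv_X_succ, Fin.cons_succ, Polynomial.map_C,
          Polynomial.C_comp]
        simp [finSuccEquiv_apply]
    rw [map_mul, map_mul, hp, hX, map_mul, Polynomial.map_mul, Polynomial.mul_comp]

/-- A polynomial of degree less than `#A * m` that vanishes to order `m` at all points of the grid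
`A × ⋯ × A` is zero. -/
theorem eq_zero_of_vanishing_grid {K : Type*} [Field K] (A : Finset K) :
    ∀ (n δ m : ℕ) (P : MvPolynomial (Fin n) K), P.totalDegree ≤ δ → δ < A.card * m →
      (∀ a : Fin n → K, (∀ j, a j ∈ A) → P ∈ vanishing a m) → P = 0
  | 0, δ, m, P, _, hm, hv => by
    have hm0 : 0 < m := Nat.pos_of_ne_zero (by rintro rfl; simp at hm)
    obtain ⟨c, rfl⟩ := C_surjective (Fin 0) P
    have := hv Fin.elim0 (fun j => j.elim0) 0 (by simpa using hm0)
    rw [algHom_C] at this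
    simp at this
    simp [this]
  | n + 1, δ, m, P, hδ, hm, hv => by
    by_contra hP
    set Q := finSuccEquiv K n P with hQ
    have hQ0 : Q ≠ 0 := by simpa [hQ] using hP
    have hlead : Q.coeff Q.natDegree ≠ 0 := by simpa using hQ0
    have hdeg := totalDegree_coeff_finSuccEquiv_add_le P Q.natDegree hlead
    rw [← hQ] at hdeg
    have hA : 0 < A.card := Nat.pos_of_ne_zero (by intro h; simp [h] at hm)
    -- Passing to the leading coefficient lowers the degree by `Q.natDegree` and costs only
    -- `Q.natDegree / A.card` in the order of vanishing.
    refine hlead (eq_zero_of_vanishing_grid A n (δ - Q.natDegree) (m - Q.natDegree / A.card) _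
      (by omega) ?_ fun a ha e he => ?_)
    · rw [Nat.mul_sub]
      have := Nat.mul_div_le Q.natDegree A.card
      omega
    · set T : MvPolynomial (Fin n) K →ₐ[K] MvPolynomial (Fin n) K := aeval (fun j => C (a j) + X j)
      have hzero : coeffwise e (Q.map T.toRingHom) = 0 := by
        refine eq_zero_of_forall_X_pow_dvd_comp A (m - e.degree) _ ?_ fun a₀ ha₀ => ?_
        · have h1 : (coeffwise e (Q.map T.toRingHom)).natDegree ≤ Q.natDegree := by
            refine Polynomial.natDegree_le_iff_coeff_eq_zero.2 fun i hi => ?_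
            rw [coeff_coeffwise, Polynomial.coeff_map, Polynomial.coeff_eq_zero_of_natDegree_lt hi,
              map_zero, coeff_zero]
          -- The floor division is chosen so that this is equivalent to the degree bound of the
          -- univariate lemma.
          have h2 : Q.natDegree / A.card < m - e.degree := by omega
          rw [Nat.div_lt_iff_lt_mul hA] at h2
          rw [mul_comm]
          omega
        · rw [Polynomial.X_pow_dvd_iff]
          intro i hi
          -- The Taylor exponent `(i, e)` has degree `i + e.degree < m`.
          have h := hv (Fin.cons a₀ a) (Fin.cases ha₀ ha) (e.cons i) (by
            rw [Finsupp.degree_eq_sum, Fin.sum_univ_succ]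
            rw [Finsupp.degree_eq_sum] at hi
            simp only [Finsupp.cons_zero, Finsupp.cons_succ]
            omega)
          rw [← finSuccEquiv_coeff_coeff, finSuccEquiv_translate] at h
          rw [← coeffwise_comp_X_add_C, coeff_coeffwise]
          exact h
      have := coeff_coeffwise e (Q.map T.toRingHom) Q.natDegree
      rw [hzero, Polynomial.coeff_map] at this
      exact this.symm

/-! ### Vanishing conditions as a matrix and their specialization -/

/-- The exponents of the monomials of degree `δ`. -/
abbrev Exponents (d δ : ℕ) : Type := {u : Fin (d + 1) →₀ ℕ // u.degree = δ}

instance (d δ : ℕ) : Fintype (Exponents d δ) :=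
  (Finsupp.finite_of_degree_eq δ).fintype

/-- The linear conditions on a polynomial to vanish to order `μ i` at the `i`-th point. -/
abbrev Conditions (d : ℕ) {r : ℕ} (μ : Fin r → ℕ) : Type :=
  (i : Fin r) × {e : Fin (d + 1) →₀ ℕ // e.degree < μ i}

/-- The coefficient of `X ^ e` in the translate by `a` of the monomial `X ^ u`. -/
def translateCoeff {R σ : Type*} [CommRing R] (a : σ → R) (e u : σ →₀ ℕ) : R :=
  coeff e (aeval (fun j => C (a j) + X j) (monomial u (1 : R)) : MvPolynomial σ R)

/-- These entries are integer polynomials in the coordinates of `a`. Hence a minor written at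
indeterminate points specializes to the minor at any points. -/
theorem map_translateCoeff {R S σ : Type*} [CommRing R] [CommRing S] (φ : R →+* S) (a : σ → R)
    (e u : σ →₀ ℕ) : φ (translateCoeff a e u) = translateCoeff (fun j => φ (a j)) e u := by
  rw [translateCoeff, translateCoeff, ← coeff_map, aeval_monomial, aeval_monomial]
  simp [Finsupp.prod, map_prod]

theorem aeval_det_translateCoeff {k L ι σ N : Type*} [Field k] [Field L] [Algebra k L] [Fintype N]
    [DecidableEq N] (p : ι → σ → L) (x : N → ι) (e u : N → σ →₀ ℕ) :
    aeval (fun ij : ι × σ => p ij.1 ij.2) (Matrix.det (Matrix.of fun v w =>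
        translateCoeff (fun j => (X (x v, j) : MvPolynomial (ι × σ) k)) (e v) (u w))) =
      Matrix.det (Matrix.of fun v w => translateCoeff (p (x v)) (e v) (u w)) := by
  rw [AlgHom.map_det]
  congr 1
  ext v w
  simpa using map_translateCoeff
    (aeval (fun ij : ι × σ => p ij.1 ij.2) : MvPolynomial (ι × σ) k →ₐ[k] L).toRingHom
    (fun j => X (x v, j)) (e v) (u w)

/-- A linear combination of monomials of degree `δ`. -/
def ofCoeffs {K : Type*} [Field K] {d δ : ℕ} (c : Exponents d δ → K) :
    MvPolynomial (Fin (d + 1)) K :=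
  ∑ u, c u • monomial u.1 (1 : K)

theorem isHomogeneous_ofCoeffs {K : Type*} [Field K] {d δ : ℕ} (c : Exponents d δ → K) :
    (ofCoeffs c).IsHomogeneous δ := by
  refine IsHomogeneous.sum _ _ _ fun u _ => ?_
  rw [smul_monomial]
  exact isHomogeneous_monomial _ u.2

theorem coeff_ofCoeffs {K : Type*} [Field K] {d δ : ℕ} (c : Exponents d δ → K)
    (u : Exponents d δ) : coeff u.1 (ofCoeffs c) = c u := by
  classical
  simp [ofCoeffs, coeff_sum, coeff_monomial, Subtype.coe_inj]

theorem ofCoeffs_coeff {K : Type*} [Field K] {d δ : ℕ} {P : MvPolynomial (Fin (d + 1)) K}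
    (hP : P.IsHomogeneous δ) : ofCoeffs (fun u : Exponents d δ => coeff u.1 P) = P := by
  ext u
  by_cases hu : u.degree = δ
  · exact coeff_ofCoeffs _ (⟨u, hu⟩ : Exponents d δ)
  · rw [(isHomogeneous_ofCoeffs _).coeff_eq_zero hu, hP.coeff_eq_zero hu]

theorem coeff_translate_ofCoeffs {K : Type*} [Field K] {d δ : ℕ} (c : Exponents d δ → K)
    (a : Fin (d + 1) → K) (e : Fin (d + 1) →₀ ℕ) :
    coeff e (aeval (fun j => C (a j) + X j) (ofCoeffs c) : MvPolynomial (Fin (d + 1)) K) =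
      ∑ u, c u * translateCoeff a e u.1 := by
  simp only [ofCoeffs, map_sum, map_smul, coeff_sum, coeff_smul, smul_eq_mul, translateCoeff]

theorem ofCoeffs_mem_forms_iff {K : Type*} [Field K] {d δ r : ℕ} (p : Fin r → Fin (d + 1) → K)
    (μ : Fin r → ℕ) (c : Exponents d δ → K) :
    ofCoeffs c ∈ forms d δ p μ ↔
      ∀ x : Conditions d μ, ∑ u, c u * translateCoeff (p x.1) x.2.1 u.1 = 0 := by
  simp only [← coeff_translate_ofCoeffs]
  rw [forms, Submodule.mem_inf, Submodule.mem_iInf, mem_homogeneousSubmodule]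
  exact ⟨fun h x => h.2 x.1 x.2.1 x.2.2,
    fun h => ⟨isHomogeneous_ofCoeffs c, fun i e he => h ⟨i, e, he⟩⟩⟩

/-- If only the zero form vanishes to the given orders at the points `p₀` over some extension of
`k`, then a polynomial over `k` that does not vanish at `p₀` certifies the same for all points at
which it does not vanish. -/
theorem exists_certificate_of_forms_eq_bot {k K : Type*} [Field k] [Field K] [Algebra k K]
    (d δ : ℕ) {r : ℕ} (p₀ : Fin r → Fin (d + 1) → K) (μ : Fin r → ℕ) (h₀ : forms d δ p₀ μ = ⊥) :
    ∃ F : MvPolynomial (Fin r × Fin (d + 1)) k, aeval (fun ij => p₀ ij.1 ij.2) F ≠ 0 ∧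
      ∀ (L : Type u) [Field L] [Algebra k L] (p : Fin r → Fin (d + 1) → L),
        aeval (fun ij => p ij.1 ij.2) F ≠ 0 → forms d δ p μ = ⊥ := by
  classical
  set row : Conditions d μ → Exponents d δ → K := fun x u => translateCoeff (p₀ x.1) x.2.1 u.1
    with hrow
  -- A nonzero functional that kills all rows would be the coefficient vector of a nonzero form in
  -- `forms d δ p₀ μ`.
  have hspan : Submodule.span K (Set.range row) = ⊤ := by
    by_contra hne
    obtain ⟨f, hf, hle⟩ := Submodule.exists_le_ker_of_lt_top _ (lt_top_iff_ne_top.2 hne)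
    have hfv : ∀ v, f v = ∑ u, f (Pi.single u 1) * v u := fun v => by
      rw [LinearMap.pi_apply_eq_sum_univ f v]
      refine Finset.sum_congr rfl fun u _ => ?_
      rw [smul_eq_mul, mul_comm]
      congr 2
      ext j
      simp [Pi.single_apply, eq_comm]
    have hmem : ofCoeffs (fun u => f (Pi.single u 1)) ∈ forms d δ p₀ μ :=
      (ofCoeffs_mem_forms_iff p₀ μ _).2 fun x =>
        (hfv (row x)).symm.trans (hle (Submodule.subset_span ⟨x, rfl⟩))
    rw [h₀, Submodule.mem_bot] at hmem
    refine hf (LinearMap.ext fun v => ?_)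
    rw [hfv]
    refine Finset.sum_eq_zero fun u _ => ?_
    rw [← coeff_ofCoeffs (fun u => f (Pi.single u 1)) u, hmem, coeff_zero, zero_mul]
  -- A basis chosen among the rows has as many members as there are monomials. Reindexed by `ε`, it
  -- gives a square matrix, whose determinant is the certificate.
  obtain ⟨κ, b, -, hb, hli⟩ := exists_linearIndependent' K row
  let B : Module.Basis κ K (Exponents d δ → K) := Module.Basis.mk hli (by rw [hb, hspan])
  let ε : Exponents d δ ≃ κ := (Pi.basisFun K (Exponents d δ)).indexEquiv B
  refine ⟨Matrix.det (Matrix.of fun v u : Exponents d δ =>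
    translateCoeff (fun j => X ((b (ε v)).1, j)) (b (ε v)).2.1 u.1), ?_, fun L _ _ p hp => ?_⟩
  · rw [aeval_det_translateCoeff]
    have hrows : LinearIndependent K (fun v : Exponents d δ => row (b (ε v))) :=
      hli.comp ε ε.injective
    have := (Matrix.linearIndependent_rows_iff_isUnit (A := Matrix.of fun v => row (b (ε v)))).1 hrows
    exact ((Matrix.isUnit_iff_isUnit_det _).1 this).ne_zero
  · rw [aeval_det_translateCoeff] at hp
    rw [eq_bot_iff]
    intro P hP
    have hhom : P.IsHomogeneous δ := (mem_homogeneousSubmodule δ P).1 hP.1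
    rw [← ofCoeffs_coeff hhom, ofCoeffs_mem_forms_iff] at hP
    have hc := Matrix.eq_zero_of_mulVec_eq_zero hp
      (v := fun u : Exponents d δ => coeff u.1 P) (by
        ext v
        simp only [Matrix.mulVec, dotProduct, Pi.zero_apply]
        simpa only [mul_comm, Matrix.of_apply] using hP (b (ε v)))
    rw [Submodule.mem_bot, ← ofCoeffs_coeff hhom, hc]
    simp [ofCoeffs]

/-! ### Forms in an affine chart -/

/-- The restriction to the affine chart where the first coordinate is `1`. -/
def dehomogenize {K : Type*} [Field K] (d : ℕ) :
    MvPolynomial (Fin (d + 1)) K →ₐ[K] MvPolynomial (Fin d) K :=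
  aeval (Fin.cons 1 X)

theorem aeval_cons_C_X {K : Type*} [Field K] {d : ℕ} (c : K) (P : MvPolynomial (Fin (d + 1)) K) :
    aeval (Fin.cons (C c) X : Fin (d + 1) → MvPolynomial (Fin d) K) P =
      (finSuccEquiv K d P).eval (C c) := by
  induction P using MvPolynomial.induction_on with
  | C c => simp [finSuccEquiv_apply]
  | add p q hp hq => rw [map_add, map_add, hp, hq, Polynomial.eval_add]
  | mul_X p j hp =>
    rw [map_mul, map_mul, hp, Polynomial.eval_mul, aeval_X]
    induction j using Fin.cases with
    | zero => rw [finSuccEquiv_X_zero, Polynomial.eval_X, Fin.cons_zero]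
    | succ j => rw [finSuccEquiv_X_succ, Polynomial.eval_C, Fin.cons_succ]

theorem coeff_dehomogenize {K : Type*} [Field K] {d : ℕ} (P : MvPolynomial (Fin (d + 1)) K)
    (e : Fin d →₀ ℕ) :
    coeff e (dehomogenize d P) =
      ∑ i ∈ Finset.range ((finSuccEquiv K d P).natDegree + 1), coeff (e.cons i) P := by
  have h := aeval_cons_C_X 1 P
  rw [C_1] at h
  rw [dehomogenize, h, Polynomial.eval_eq_sum_range, coeff_sum]
  simp [finSuccEquiv_coeff_coeff]

theorem degree_cons {d : ℕ} (e : Fin d →₀ ℕ) (i : ℕ) : (e.cons i).degree = i + e.degree := by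
  simp [Finsupp.degree_eq_sum, Fin.sum_univ_succ]

theorem totalDegree_dehomogenize_le {K : Type*} [Field K] {d δ : ℕ}
    {P : MvPolynomial (Fin (d + 1)) K} (hP : P.IsHomogeneous δ) :
    (dehomogenize d P).totalDegree ≤ δ := by
  refine Finset.sup_le fun e he => ?_
  change e.degree ≤ δ
  obtain ⟨i, -, hi⟩ := Finset.exists_ne_zero_of_sum_ne_zero
    ((coeff_dehomogenize P e).symm.trans_ne (mem_support_iff.1 he))
  have hdeg : (e.cons i).degree = δ := by
    by_contra h
    exact hi (hP.coeff_eq_zero h)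
  rw [degree_cons] at hdeg
  omega

/-- In a form, the exponent of the first variable is determined by the other exponents, so setting
that variable to `1` merges no monomials. -/
theorem eq_zero_of_dehomogenize_eq_zero {K : Type*} [Field K] {d δ : ℕ}
    {P : MvPolynomial (Fin (d + 1)) K} (hP : P.IsHomogeneous δ) (h : dehomogenize d P = 0) :
    P = 0 := by
  ext u
  by_contra hu
  rw [coeff_zero] at hu
  have hcons : u.tail.cons (u 0) = u := Finsupp.cons_tail u
  have hdeg : ∀ i, coeff (u.tail.cons i) P ≠ 0 → i = u 0 := fun i hi => by
    have h1 : (u.tail.cons i).degree = δ := by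
      by_contra h
      exact hi (hP.coeff_eq_zero h)
    have h2 : u.degree = δ := by
      by_contra h
      exact hu (hP.coeff_eq_zero h)
    rw [← hcons, degree_cons] at h2
    rw [degree_cons] at h1
    omega
  have hsum := coeff_dehomogenize P u.tail
  rw [h, coeff_zero, Finset.sum_eq_single (u 0), hcons] at hsum
  · exact hu hsum.symm
  · intro i _ hi
    by_contra hne
    exact hi (hdeg i hne)
  · intro hmem
    rw [← finSuccEquiv_coeff_coeff, Polynomial.coeff_eq_zero_of_natDegree_lt, coeff_zero]
    simpa using hmem

/-- In coordinates centred at `(1, a)` the chart is the hyperplane where the first variable is `0`,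
so the Taylor coefficients of the restriction are among those of `P`. -/
theorem dehomogenize_mem_vanishing {K : Type*} [Field K] {d m : ℕ} (a : Fin d → K)
    {P : MvPolynomial (Fin (d + 1)) K} (hP : P ∈ vanishing (Fin.cons 1 a : Fin (d + 1) → K) m) :
    dehomogenize d P ∈ vanishing a m := by
  intro e he
  have hcomp : aeval (fun j => C (a j) + X j) (dehomogenize d P) =
      aeval (Fin.cons (C 0) X : Fin (d + 1) → MvPolynomial (Fin d) K)
        (aeval (fun j => C ((Fin.cons 1 a : Fin (d + 1) → K) j) + X j) P :
          MvPolynomial (Fin (d + 1)) K) := by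
    rw [dehomogenize, ← AlgHom.comp_apply, ← AlgHom.comp_apply, comp_aeval, comp_aeval]
    congr 2
    funext j
    induction j using Fin.cases with
    | zero => simp
    | succ j => simp
  rw [hcomp, aeval_cons_C_X, C_0, ← Polynomial.coeff_zero_eq_eval_zero, finSuccEquiv_coeff_coeff]
  exact hP _ (by rwa [degree_cons, zero_add])

/-- No nonzero form of degree less than `s * m` vanishes to order `m` at the `s ^ d` points of a
grid in an affine chart. -/
theorem exists_points_forms_eq_bot (K : Type*) [Field K] [Infinite K] (d s δ m : ℕ)
    (hδ : δ < s * m) :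
    ∃ p : Fin (s ^ d) → Fin (d + 1) → K, forms d δ p (fun _ => m) = ⊥ := by
  obtain ⟨A, hA⟩ := Infinite.exists_subset_card_eq K s
  let x : Fin s ≃ A := (finCongr hA.symm).trans A.equivFin.symm
  refine ⟨fun i => Fin.cons 1 fun j => (x (finFunctionFinEquiv.symm i j) : K), ?_⟩
  rw [eq_bot_iff]
  rintro P ⟨hhom, hv⟩
  have hhom : P.IsHomogeneous δ := (mem_homogeneousSubmodule δ P).1 hhom
  rw [SetLike.mem_coe, Submodule.mem_iInf] at hv
  refine eq_zero_of_dehomogenize_eq_zero hhom (eq_zero_of_vanishing_grid A d δ m _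
    (totalDegree_dehomogenize_le hhom) (by rwa [hA]) fun a ha => dehomogenize_mem_vanishing a ?_)
  have := hv (finFunctionFinEquiv fun j => x.symm ⟨a j, ha j⟩)
  simpa using this

end FatPoints

end

/-! ### General and generic points -/

/-- Let `r` be a `d`-th power and `δ < r^(1/d) μ`. Then `l(d, δ, μ^r) = 0`: no nonzero form of
degree `δ` vanishes to order `μ` at `r` generic points of `ℙ^d`. Equivalently, in terms of general
points, this holds for all `r`-tuples of points of `ℙ^d`, rational over any extension of `k`,
outside a proper closed subset that is defined over `k`. -/
theorem theorem3 {k : Type u} [Field k] (d r δ μ : ℕ) (hd : 2 ≤ d)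
    (hr : ∃ s : ℕ, r = s ^ d) (hδ : (δ : ℝ) < (r : ℝ) ^ (1 / (d : ℝ)) * (μ : ℝ)) :
    FatPoints.l k d δ (fun _ : Fin r => μ) = 0 ∧
      ∃ F : MvPolynomial (Fin r × Fin (d + 1)) k, F ≠ 0 ∧
        ∀ (L : Type u) [Field L] [Algebra k L] (p : Fin r → Fin (d + 1) → L),
          (∀ i, p i ≠ 0) → MvPolynomial.aeval (fun ij => p ij.1 ij.2) F ≠ 0 →
            Module.finrank L (FatPoints.forms d δ p (fun _ => μ)) = 0 := by
  obtain ⟨s, rfl⟩ := hr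
  have hlt : δ < s * μ := by
    rw [Nat.cast_pow, one_div, Real.pow_rpow_inv_natCast s.cast_nonneg (by omega)] at hδ
    exact_mod_cast hδ
  -- A finite `k` may have fewer than `s` elements, so the grid is taken over the algebraic closure;
  -- the certificate still has coefficients in `k`.
  obtain ⟨p₀, hp₀⟩ := FatPoints.exists_points_forms_eq_bot (AlgebraicClosure k) d s δ μ hlt
  obtain ⟨F, hF₀, hF⟩ := FatPoints.exists_certificate_of_forms_eq_bot (k := k) d δ p₀ _ hp₀
  have hne : F ≠ 0 := by
    rintro rfl
    exact hF₀ (map_zero _)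
  refine ⟨?_, F, hne, fun L _ _ p _ hp => ?_⟩
  -- At the generic points `F` takes as value its own image in the fraction field, which is nonzero
  -- because `F` is.
  · have hgen : aeval (fun ij : Fin (s ^ d) × Fin (d + 1) =>
        FatPoints.genericPoints k d (s ^ d) ij.1 ij.2) F = algebraMap _ _ F := by
      have := aeval_algebraMap_apply (FatPoints.GenericField k d (s ^ d))
        (X : _ → MvPolynomial (Fin (s ^ d) × Fin (d + 1)) k) F
      rwa [aeval_X_left_apply] at this
    rw [FatPoints.l, hF _ (FatPoints.genericPoints k d (s ^ d)), finrank_bot]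
    rw [hgen]
    exact (map_ne_zero_iff _ (IsFractionRing.injective _ _)).2 hne
  · rw [hF L p hp, finrank_bot]
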